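/- **Setting.** Consider decentralized federated learning (D-FL) with devices $n=1,\dots,N$ and models in $\mathbb R^M$. Device $n$ owns a finite non-empty dataset $\mathcal D_n$, has the local loss $F_n(\omega)=\frac1{|\mathcal D_n|}\sum_{d\in\mathcal D_n}f(d,\omega)$ with $f(d,\cdot)$ differentiable, and the weight $p_n=|\mathcal D_n|/\sum_m|\mathcal D_m|$. Let $F=\sum_np_nF_n$ and let $\omega^*$ be a minimizer of $F$. In round $t$ the topology is an undirected graph $\mathcal G^t$ without self-loops. (Local training.) For $i=1,\dots,I$ ($I\ge1$), $\omega_{n,i}^t=\omega_{n,i-1}^t-\eta\,\mathbf g^t_{\xi,n,i-1}$, where $\eta>0$ and $\mathbf g^t_{\xi,n,i}=\frac1{|\xi^t_{n,i}|}\sum_{d\in\xi^t_{n,i}}\nabla f(d,\omega^t_{n,i})$ for a random non-empty mini-batch $\xi_{n,i}^t\subseteq\mathcal D_n$. (Local aggregation over imperfect channels.) Put $\mathbf w_{n,0}^t=Np_n\omega_{n,I}^t$ and, for $j=1,\dots,J$ ($J\ge1$), $\mathbf w_{n,j}^t=\sum_mc_{n,m}^t(\mathbf e^t_{n,m,j}\circ\mathbf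 w^t_{m,j-1})$. The next round starts from $\omega_{n,0}^{t+1}=\mathbf w_{n,J}^t$; the models $\omega^1_{n,0}$ are given. Here $\mathbf e^t_{n,m,j}\in\{0,1\}^M$ is constant on packets of $L_{\mathrm p}$ consecutive elements, and a packet from $m$ is received at $n$ (the corresponding entries are $1$) with probability $1-\epsilon^t_{n,m}$, where $\epsilon^t_{n,m}=1-(1-\epsilon^t_{\mathrm B,n,m})^{32L_{\mathrm p}}$ for $n\ne m$, with bit error rates $\epsilon^t_{\mathrm B,n,m}\in[0,1]$, and $\epsilon_{n,n}^t=0$. All mini-batches and packet receptions are independent. With $d_n^t$ the degree of $n$ in $\mathcal G^t$ and $\alpha^t\in\mathbb R$ a constant of the round, $c^t_{n,n}=1-d_n^t\alpha^t$, $c^t_{n,m}=0$ for non-adjacent $n\neq m$, and for adjacent $n,m$ either always $c^t_{n,m}=\alpha^t$ (channel unknown) or always $c_{n,m}^t=\alpha^t/(1-\epsilon^t_{n,m})$ (channel known; then $\epsilon^t_{\mathrm B,n,m}<1$ on edges). **Assumptions.** There are $L,\mu,G>0$ and $\sigma_n$ such that all $F_n$ and $F$ are $L$-smooth and $\mu$-strongly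 convex and, for all $n$, $t$ and $i<I$, where $\mathbb E_\xi$ is the expectation over the mini-batch $\xi^t_{n,i}$ with the iterate $\omega^t_{n,i}$ fixed, almost surely $\mathbb E_\xi\|\mathbf g^t_{\xi,n,i}\|^2\le G^2$, $\mathbb E_\xi\|\mathbf g^t_{\xi,n,i}-\nabla F_n(\omega^t_{n,i})\|^2\le\sigma_n^2$ and $\mathbb E_\xi\,\mathbf g^t_{\xi,n,i}=\nabla F_n(\omega^t_{n,i})$. **Claim.** Let $\bar\omega_I^t=\sum_np_n\omega_{n,I}^t$, $\Delta\omega_I^t=\|\bar\omega_I^t-\omega^*\|^2$ and $\varpi_n^t=\bar\omega_I^t-\mathbf w_{n,J}^t$. Then, with $\mathbb E$ the expectation over all the randomness, for every round $t$ $$\mathbb E\Big(\sum_np_n\|\mathbf w_{n,J}^t-\omega^*\|^2\Big)\le2\Big(\mathbb E(\Delta\omega_I^t)+\mathbb E\Big(\sum_np_n\|\varpi_n^t\|^2\Big)\Big)<\infty,$$ and, as $t\to\infty$, $$\limsup_{t\to\infty}\mathbb E\Big(\sum_np_n\|\mathbf w_{n,J}^t-\omega^*\|^2\Big)\le2\Big(\limsup_{t\to\infty}\mathbb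 E(\Delta\omega_I^t)+\limsup_{t\to\infty}\mathbb E\Big(\sum_np_n\|\varpi_n^t\|^2\Big)\Big)<\infty.$$ In particular $\limsup_{t\to\infty}\mathbb E\|\mathbf w_{n,J}^t-\omega^*\|^2<\infty$ for every device $n$. -/

import Mathlib

open MeasureTheory ProbabilityTheory Filter
open scoped ENNReal NNReal BigOperators

namespace DFL

/-- The space `ℝ^M` of model parameters, with the Euclidean norm. -/
abbrev Param (M : ℕ) : Type := EuclideanSpace ℝ (Fin M)

/-- The two designs of the consensus matrix: the channel conditions are unknown or known a priori. -/
inductive Design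
  | unknownChannel
  | knownChannel

/-- The deterministic data of a decentralized federated learning (D-FL) system with `N` devices,
models in `ℝ^M` and data samples in `δ`. Rounds are numbered `0, 1, 2, …`. -/
structure System (N M : ℕ) (δ : Type*) where
  /-- the dataset of each device -/
  data : Fin N → Finset δ
  data_nonempty : ∀ n, (data n).Nonempty
  /-- the loss `f(d, ω)` of the model `ω` on the sample `d` -/
  loss : δ → Param M → ℝ
  loss_differentiable : ∀ n, ∀ d ∈ data n, Differentiable ℝ (loss d)
  /-- the learning rate `η` -/
  rate : ℝ
  rate_pos : 0 < rate
  /-- the number `I` of local training iterations per round -/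
  numLocal : ℕ
  numLocal_pos : 0 < numLocal
  /-- the number `J` of local aggregations per round -/
  numAgg : ℕ
  numAgg_pos : 0 < numAgg
  /-- the number of model elements per packet -/
  packetLen : ℕ
  packetLen_pos : 0 < packetLen
  /-- the network topology of each round -/
  graph : ℕ → SimpleGraph (Fin N)
  /-- the bit error rate from device `m` (last argument) to device `n` in each round -/
  ber : ℕ → Fin N → Fin N → ℝ
  ber_mem : ∀ t n m, ber t n m ∈ Set.Icc (0 : ℝ) 1
  /-- the design of the consensus matrix -/
  design : Design
  ber_lt_one : design = Design.knownChannel → ∀ t n m, (graph t).Adj n m → ber t n m < 1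
  /-- the aggregation constant `α^t` of each round -/
  alpha : ℕ → ℝ
  /-- the initial local models -/
  init : Fin N → Param M

namespace System

variable {N M : ℕ} {δ : Type*} (S : System N M δ)

/-- The weight `p_n = D_n / ∑_m D_m` of device `n`. -/
noncomputable def p (n : Fin N) : ℝ :=
  ((S.data n).card : ℝ) / ∑ m, ((S.data m).card : ℝ)

/-- The local loss `F_n`. -/
noncomputable def localLoss (n : Fin N) (x : Param M) : ℝ :=
  (1 / ((S.data n).card : ℝ)) * ∑ d ∈ S.data n, S.loss d x

/-- The global loss `F = ∑ p_n F_n`. -/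
noncomputable def globalLoss (x : Param M) : ℝ :=
  ∑ n, S.p n * S.localLoss n x

/-- The mini-batch gradient `(1 / |ξ|) ∑_{d ∈ ξ} ∇f(d, x)`. -/
noncomputable def batchGrad (ξ : Finset δ) (x : Param M) : Param M :=
  (1 / (ξ.card : ℝ)) • ∑ d ∈ ξ, gradient (S.loss d) x

/-- The packet error rate: `32` bits per element; a device has its own model without error. -/
noncomputable def per (t : ℕ) (n m : Fin N) : ℝ :=
  if n = m then 0 else 1 - (1 - S.ber t n m) ^ (32 * S.packetLen)

open Classical in
/-- The coefficient `c^t_{n,m}` that device `n` applies to the model received from device `m`. -/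
noncomputable def coeff (t : ℕ) (n m : Fin N) : ℝ :=
  if n = m then 1 - ((S.graph t).degree n : ℝ) * S.alpha t
  else if (S.graph t).Adj n m then
    match S.design with
    | Design.unknownChannel => S.alpha t
    | Design.knownChannel => S.alpha t / (1 - S.per t n m)
  else 0

/-- The number `⌈M / L_p⌉` of packets of a model. -/
def numPackets (_S : System N M δ) : ℕ := ⌈(M : ℚ) / (_S.packetLen : ℚ)⌉₊

/-- Keep the elements of `x` in the packets that were received and set the others to zero: this is
`e ∘ x` for the 0-1 reception vector `e` that is constant on packets. -/
noncomputable def receivedPart (ok : ℕ → Bool) (x : Param M) : Param M :=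
  WithLp.toLp 2 fun k : Fin M => if ok ((k : ℕ) / S.packetLen) = true then x k else 0

end System

/-- The randomness of the system: the mini-batches and the packet receptions.
`batch t n i` is the mini-batch of device `n` for the gradient at its `i`-th local model in round
`t` (`i < I`); `received t n m j l` says whether packet `l` sent by `m` reaches `n` error-free for
the `(j+1)`-st aggregation of round `t` (`j < J`). All of these are independent. -/
structure Randomness {N M : ℕ} {δ : Type*} (S : System N M δ) {Ω : Type*} [MeasurableSpace Ω]
    (P : Measure Ω) where
  batch : ℕ → Fin N → ℕ → Ω → Finset δ
  batch_subset : ∀ t n i s, i < S.numLocal → batch t n i s ⊆ S.data n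
  batch_nonempty : ∀ t n i s, i < S.numLocal → (batch t n i s).Nonempty
  batch_measurable : ∀ t n i, i < S.numLocal → Measurable[_, ⊤] (batch t n i)
  received : ℕ → Fin N → Fin N → ℕ → ℕ → Ω → Bool
  received_measurable : ∀ t n m j l, j < S.numAgg → l < S.numPackets →
    Measurable (received t n m j l)
  received_prob : ∀ t n m j l, j < S.numAgg → l < S.numPackets →
    P {s | received t n m j l s = true} = ENNReal.ofReal (1 - S.per t n m)
  indep : iIndep
    (Sum.elim
      (fun q : ℕ × Fin N × Fin S.numLocal =>
        MeasurableSpace.comap (batch q.1 q.2.1 q.2.2) ⊤)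
      (fun q : ℕ × Fin N × Fin N × Fin S.numAgg × Fin S.numPackets =>
        MeasurableSpace.comap (received q.1 q.2.1 q.2.2.1 q.2.2.2.1 q.2.2.2.2) ⊤)) P

namespace Randomness

variable {N M : ℕ} {δ : Type*} {S : System N M δ} {Ω : Type*} [MeasurableSpace Ω]
  {P : Measure Ω} (R : Randomness S P)

/-- Local training of device `n` in round `t` by stochastic gradient descent from `x`. -/
noncomputable def train (t : ℕ) (s : Ω) (n : Fin N) (x : Param M) : ℕ → Param M
  | 0 => x
  | i + 1 => train t s n x i - S.rate • S.batchGrad (R.batch t n i s) (train t s n x i)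

/-- Imperfect local aggregations in round `t` from the models `W`. -/
noncomputable def aggregate (t : ℕ) (s : Ω) (W : Fin N → Param M) : ℕ → Fin N → Param M
  | 0 => W
  | j + 1 => fun n => ∑ m, S.coeff t n m •
      S.receivedPart (fun l => R.received t n m j l s) (aggregate t s W j m)

/-- The models `ω^t_{n,0}` with which round `t` starts: the initial models in the first round, then
the output of the aggregations of the previous round, which start from `N p_m ω^t_{m,I}`. -/
noncomputable def start (s : Ω) : ℕ → Fin N → Param M
  | 0 => S.init
  | t + 1 => R.aggregate t s
      (fun m => ((N : ℝ) * S.p m) • R.train t s m (start s t m) S.numLocal) S.numAgg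

/-- The local model `ω^t_{n,i}`. -/
noncomputable def localModel (t : ℕ) (n : Fin N) (i : ℕ) (s : Ω) : Param M :=
  R.train t s n (R.start s t n) i

/-- The locally aggregated model `w^t_{n,j}`; in particular `w^t_{n,0} = N p_n ω^t_{n,I}`. -/
noncomputable def aggModel (t : ℕ) (n : Fin N) (j : ℕ) (s : Ω) : Param M :=
  R.aggregate t s (fun m => ((N : ℝ) * S.p m) • R.localModel t m S.numLocal s) j n

/-- The virtual global model `∑ p_n ω^t_{n,I}` after the local training of round `t`. -/
noncomputable def globalModel (t : ℕ) (s : Ω) : Param M :=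
  ∑ n, S.p n • R.localModel t n S.numLocal s

/-- The bias `ϖ^t_n` of the locally aggregated model of device `n`. -/
noncomputable def bias (t : ℕ) (n : Fin N) (s : Ω) : Param M :=
  R.globalModel t s - R.aggModel t n S.numAgg s

/-- The expectation of `‖w^t_{n,J} - x‖²`. -/
noncomputable def deviceError (x : Param M) (n : Fin N) (t : ℕ) : ℝ≥0∞ :=
  ∫⁻ s, ENNReal.ofReal (‖R.aggModel t n S.numAgg s - x‖ ^ 2) ∂P

/-- The expectation of `∑ p_n ‖w^t_{n,J} - x‖²`. -/
noncomputable def weightedError (x : Param M) (t : ℕ) : ℝ≥0∞ :=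
  ∫⁻ s, ENNReal.ofReal (∑ n, S.p n * ‖R.aggModel t n S.numAgg s - x‖ ^ 2) ∂P

/-- The expectation of the squared distance between the virtual global model and `x`. -/
noncomputable def globalError (x : Param M) (t : ℕ) : ℝ≥0∞ :=
  ∫⁻ s, ENNReal.ofReal (‖R.globalModel t s - x‖ ^ 2) ∂P

/-- The expectation of `∑ p_n ‖ϖ^t_n‖²`. -/
noncomputable def biasError (t : ℕ) : ℝ≥0∞ :=
  ∫⁻ s, ENNReal.ofReal (∑ n, S.p n * ‖R.bias t n s‖ ^ 2) ∂P

end Randomness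

/-- The standing assumptions: smoothness, strong convexity, and bounds on the stochastic gradients
along the iterates. An inner integral over `s'` is the expectation over the mini-batch alone, the
iterate being fixed. -/
structure Assumptions {N M : ℕ} {δ : Type*} {S : System N M δ} {Ω : Type*} [MeasurableSpace Ω]
    {P : Measure Ω} (R : Randomness S P) (L μ G : ℝ) (σ : Fin N → ℝ) : Prop where
  L_pos : 0 < L
  μ_pos : 0 < μ
  G_pos : 0 < G
  local_smooth : ∀ n x y,
    ‖gradient (S.localLoss n) x - gradient (S.localLoss n) y‖ ≤ L * ‖x - y‖
  global_smooth : ∀ x y,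
    ‖gradient S.globalLoss x - gradient S.globalLoss y‖ ≤ L * ‖x - y‖
  local_strongConvex : ∀ n, StrongConvexOn Set.univ μ (S.localLoss n)
  global_strongConvex : StrongConvexOn Set.univ μ S.globalLoss
  second_moment : ∀ t n i, i < S.numLocal → ∀ᵐ s ∂P,
    ∫ s', ‖S.batchGrad (R.batch t n i s') (R.localModel t n i s)‖ ^ 2 ∂P ≤ G ^ 2
  variance : ∀ t n i, i < S.numLocal → ∀ᵐ s ∂P,
    ∫ s', ‖S.batchGrad (R.batch t n i s') (R.localModel t n i s)
      - gradient (S.localLoss n) (R.localModel t n i s)‖ ^ 2 ∂P ≤ σ n ^ 2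
  unbiased : ∀ t n i, i < S.numLocal → ∀ᵐ s ∂P,
    ∫ s', S.batchGrad (R.batch t n i s') (R.localModel t n i s) ∂P
      = gradient (S.localLoss n) (R.localModel t n i s)

end DFL

/-! The inequality for a fixed round is pointwise: `w - x = (ω̄ - x) - ϖ` for each device, and `‖a -
b‖² ≤ 2‖a‖² + 2‖b‖²`, averaged with the weights `p_n`. The substance is finiteness, uniformly in the
round.

Finiteness needs no analysis of the channels. At an iterate with index `i < I`, unbiasedness and the
second-moment bound control `‖∇F_n‖` by a constant; strong convexity gives `μ‖x‖ ≤ ‖∇F_n x - ∇F_n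
0‖`, so the iterate almost surely lies in a ball fixed for all rounds (`ae_norm_localModel_le`). The
aggregated model is the iterate `i = 0` of the next round (`aggModel_numAgg`), hence lies in this
ball, whatever the channels did.

The model after the last local step has index `I` and escapes this argument. It is one gradient step
away from an iterate in the ball, and that step is bounded in mean square because the mini-batch is
independent of the iterate (`lintegral_batchGrad_sq_le`). Thus the global error and the bias error
are bounded over all rounds, and the limit superior is subadditive. -/

namespace DFL

/-! ### Strong monotonicity of the gradient -/

section Convexity

variable {E : Type*} [NormedAddCommGroup E] [InnerProductSpace ℝ E]

/-- Along the segment from `x` to `y`, the function `F - μ/2 ‖·‖²` is convex in one real variable,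
so its derivative at `0` is at most its derivative at `1`. -/
lemma strongConvexOn_inner_gradient [CompleteSpace E] {F : E → ℝ} {μ : ℝ}
    (hF : StrongConvexOn Set.univ μ F) (hd : Differentiable ℝ F) (x y : E) :
    μ * ‖y - x‖ ^ 2 ≤ inner ℝ (gradient F y - gradient F x) (y - x) := by
  rw [strongConvexOn_iff_convex] at hF
  set v := y - x with hv
  have hline : ∀ t : ℝ, HasDerivAt (fun t : ℝ => x + t • v) v t := fun t => by
    simpa using ((hasDerivAt_id t).smul_const v).const_add x
  have hder : ∀ t : ℝ, HasDerivAt (fun t : ℝ => F (x + t • v) - μ / 2 * ‖x + t • v‖ ^ 2)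
      (inner ℝ (gradient F (x + t • v)) v - μ * inner ℝ (x + t • v) v) t := fun t => by
    have h1 := ((hd (x + t • v)).hasGradientAt.hasFDerivAt).comp_hasDerivAt t (hline t)
    have h2 := ((hline t).norm_sq).const_mul (μ / 2)
    refine (h1.sub h2).congr_deriv ?_
    simp only [InnerProductSpace.toDual_apply_apply]
    ring
  have hconv : ConvexOn ℝ Set.univ (fun t : ℝ => F (x + t • v) - μ / 2 * ‖x + t • v‖ ^ 2) := by
    have h := hF.comp_affineMap (AffineMap.lineMap x y)
    have he : (fun t : ℝ => F (x + t • v) - μ / 2 * ‖x + t • v‖ ^ 2)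
        = (fun z => F z - μ / 2 * ‖z‖ ^ 2) ∘ (AffineMap.lineMap x y : ℝ →ᵃ[ℝ] E) := by
      funext t
      simp [AffineMap.lineMap_apply, hv, add_comm]
    rw [he]
    simpa using h
  have hmono := hconv.monotoneOn_deriv (fun t _ => (hder t).differentiableAt)
    (Set.mem_univ 0) (Set.mem_univ 1) zero_le_one
  rw [(hder 0).deriv, (hder 1).deriv] at hmono
  have hy : x + (1 : ℝ) • v = y := by simp [hv]
  rw [hy, zero_smul, add_zero] at hmono
  have hvv : inner ℝ y v - inner ℝ x v = ‖v‖ ^ 2 := by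
    rw [← inner_sub_left, ← hv, real_inner_self_eq_norm_sq]
  rw [inner_sub_left, ← hvv]
  linarith

lemma norm_sub_le_of_strongConvexOn [CompleteSpace E] {F : E → ℝ} {μ : ℝ}
    (hF : StrongConvexOn Set.univ μ F) (hd : Differentiable ℝ F) (x y : E) :
    μ * ‖y - x‖ ≤ ‖gradient F y - gradient F x‖ := by
  rcases (norm_nonneg (y - x)).eq_or_lt with h | h
  · rw [← h]; simp
  · have h1 := (strongConvexOn_inner_gradient hF hd x y).trans (real_inner_le_norm _ _)
    refine le_of_mul_le_mul_right ?_ h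
    linarith [h1, sq ‖y - x‖]

end Convexity

/-! ### Finitely valued random variables and independence -/

section FiniteValued

variable {Ω α E : Type*}

lemma integrable_of_mem_finset [MeasurableSpace Ω] {P : Measure Ω} [IsFiniteMeasure P]
    [NormedAddCommGroup E] {b : Ω → α} (hb : Measurable[_, ⊤] b) {D : Finset α}
    (hD : ∀ s, b s ∈ D) (φ : α → E) : Integrable (fun s => φ (b s)) P := by
  classical
  let f : SimpleFunc Ω E :=
    { toFun := fun s => φ (b s)
      measurableSet_fiber' := fun x => hb (t := {a | φ a = x}) trivial
      finite_range' := (D.finite_toSet.image φ).subset (by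
        rintro _ ⟨s, rfl⟩
        exact ⟨b s, hD s, rfl⟩) }
  exact f.integrable_of_isFiniteMeasure

/-- If the finitely valued `b` and `X` are independent, the expectation of `H (b, X)` can be
computed by first averaging over `b` alone. -/
lemma lintegral_eq_iterated_of_indep [MeasurableSpace E] {mX mΩ : MeasurableSpace Ω}
    {P : Measure Ω} (hmX : mX ≤ mΩ)
    {b : Ω → α} (hb : Measurable[_, ⊤] b) {D : Finset α} (hD : ∀ s, b s ∈ D)
    {X : Ω → E} (hX : Measurable[mX] X)
    (hind : Indep mX (MeasurableSpace.comap b ⊤) P)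
    {H : α → E → ℝ≥0∞} (hH : ∀ a, Measurable (H a)) :
    ∫⁻ s, H (b s) (X s) ∂P = ∫⁻ s, ∫⁻ s', H (b s') (X s) ∂P ∂P := by
  classical
  have hset : ∀ a, MeasurableSet {s | b s = a} := fun a => hb (t := {a}) trivial
  have hX' : Measurable X := hX.mono hmX le_rfl
  -- Splitting over the values of `b` makes each term a function of `X` times the indicator of an
  -- event independent of `X`, so its integral factors.
  have hsplit : ∀ s' x, H (b s') x
      = ∑ a ∈ D, H a x * ({s | b s = a}.indicator (fun _ => (1 : ℝ≥0∞)) s') := by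
    intro s' x
    rw [Finset.sum_eq_single (b s')]
    · simp
    · intro a _ ha
      simp [Ne.symm ha]
    · intro h
      exact absurd (hD s') h
  have hinner : ∀ x, ∫⁻ s', H (b s') x ∂P = ∑ a ∈ D, H a x * P {s | b s = a} := by
    intro x
    simp_rw [fun s' => hsplit s' x]
    rw [lintegral_finsetSum]
    · refine Finset.sum_congr rfl fun a _ => ?_
      rw [lintegral_const_mul _ (measurable_const.indicator (hset a)),
        lintegral_indicator_const (hset a), one_mul]
    · exact fun a _ => (measurable_const.indicator (hset a)).const_mul _
  simp_rw [hinner]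
  have hHX : ∀ a, Measurable fun s => H a (X s) := fun a => (hH a).comp hX'
  rw [lintegral_finsetSum _ fun a _ => (hHX a).mul_const _]
  rw [lintegral_congr fun s => hsplit s (X s), lintegral_finsetSum (f := fun a s =>
    H a (X s) * ({s | b s = a}.indicator (fun _ => (1 : ℝ≥0∞)) s)) _ fun a _ =>
    (hHX a).mul (measurable_const.indicator (hset a))]
  refine Finset.sum_congr rfl fun a _ => ?_
  rw [lintegral_mul_const _ (hHX a)]
  have hI : IndepSets {s | MeasurableSet[mX] s} {{s | b s = a}} P := by
    refine indepSets_of_indepSets_of_le_right ((Indep_iff_IndepSets _ _ P).1 hind) ?_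
    rw [Set.singleton_subset_iff]
    exact ⟨{a}, trivial, rfl⟩
  rw [lintegral_mul_indicator_eq_lintegral_mul_lintegral_indicator (f := fun s => H a (X s)) hmX 1
    (hset a) hI ((hH a).comp hX), lintegral_indicator_const (hset a), one_mul]

end FiniteValued

/-! ### Weights, packets and measurability of the basic operations -/

lemma measurable_gradient {M : ℕ} (f : Param M → ℝ) : Measurable (gradient f) :=
  (InnerProductSpace.toDual ℝ (Param M)).symm.continuous.measurable.comp (measurable_fderiv ℝ f)

namespace System

variable {N M : ℕ} {δ : Type*} (S : System N M δ)

lemma measurable_batchGrad (A : Finset δ) : Measurable (S.batchGrad A) := by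
  unfold batchGrad
  exact (Finset.measurable_sum _ fun d _ => measurable_gradient (S.loss d)).const_smul
    (1 / (A.card : ℝ))

lemma differentiable_localLoss (n : Fin N) : Differentiable ℝ (S.localLoss n) := by
  unfold localLoss
  exact (Differentiable.fun_sum fun d hd => S.loss_differentiable n d hd).const_mul _

lemma p_nonneg (n : Fin N) : 0 ≤ S.p n := by
  unfold p; positivity

lemma sum_p (n : Fin N) : ∑ m, S.p m = 1 := by
  unfold p
  rw [← Finset.sum_div]
  refine div_self (ne_of_gt (Finset.sum_pos' (fun _ _ => by positivity) ⟨n, Finset.mem_univ n, ?_⟩))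
  exact_mod_cast (S.data_nonempty n).card_pos

lemma sum_p_mul_le {a : Fin N → ℝ} {C : ℝ} (hC : 0 ≤ C) (h : ∀ n, a n ≤ C) :
    ∑ n, S.p n * a n ≤ C := by
  rcases isEmpty_or_nonempty (Fin N) with _ | ⟨⟨n⟩⟩
  · simpa using hC
  · calc ∑ n, S.p n * a n ≤ ∑ n, S.p n * C :=
          Finset.sum_le_sum fun n _ => mul_le_mul_of_nonneg_left (h n) (S.p_nonneg n)
      _ = C := by rw [← Finset.sum_mul, S.sum_p n, one_mul]

/-- Receptions are known to be measurable only for genuine packet indices; this shows that no other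
index is consulted. -/
lemma div_packetLen_lt_numPackets (k : Fin M) : (k : ℕ) / S.packetLen < S.numPackets := by
  have hL : (0 : ℚ) < S.packetLen := by exact_mod_cast S.packetLen_pos
  unfold numPackets
  rw [Nat.lt_ceil]
  refine (Nat.cast_div_le).trans_lt ?_
  gcongr
  exact k.2

end System

lemma measurable_batchGrad_comp {N M : ℕ} {δ Ω : Type*} (S : System N M δ)
    {m : MeasurableSpace Ω} {b : Ω → Finset δ} (hb : Measurable[m, ⊤] b) {D : Finset δ}
    (hD : ∀ s, b s ⊆ D) {X : Ω → Param M} (hX : Measurable[m] X) :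
    Measurable[m] fun s => S.batchGrad (b s) (X s) := by
  classical
  have h : (fun s => S.batchGrad (b s) (X s))
      = fun s => ∑ A ∈ D.powerset, if b s = A then S.batchGrad A (X s) else 0 := by
    funext s
    rw [Finset.sum_ite_eq, if_pos (Finset.mem_powerset.2 (hD s))]
  rw [h]
  refine Finset.measurable_sum _ fun A _ => Measurable.ite (hb (t := {A}) trivial) ?_ ?_
  · exact (S.measurable_batchGrad A).comp hX
  · exact measurable_const

lemma measurable_receivedPart {N M : ℕ} {δ Ω : Type*} (S : System N M δ)
    {m : MeasurableSpace Ω} {ok : ℕ → Ω → Bool} (hok : ∀ l < S.numPackets, Measurable[m] (ok l))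
    {X : Ω → Param M} (hX : Measurable[m] X) :
    Measurable[m] fun s => S.receivedPart (fun l => ok l s) (X s) := by
  unfold System.receivedPart
  refine (WithLp.measurable_toLp 2 (Fin M → ℝ)).comp (measurable_pi_lambda _ fun k => ?_)
  refine Measurable.ite ?_ ?_ measurable_const
  · exact hok _ (S.div_packetLen_lt_numPackets k) (t := {true}) trivial
  · exact (measurable_pi_apply k).comp ((WithLp.measurable_ofLp 2 (Fin M → ℝ)).comp hX)

/-! ### Measurability of the iterates and their independence of the next mini-batch -/

namespace Randomness

section Measurability

variable {N M : ℕ} {δ : Type*} {S : System N M δ} {Ω : Type*} {m mΩ : MeasurableSpace Ω}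
  {P : Measure Ω} (R : Randomness S P)

lemma measurable_train {t : ℕ} {n : Fin N} {i : ℕ} (hi : i ≤ S.numLocal)
    (hb : ∀ k < i, Measurable[m, ⊤] (R.batch t n k)) {X : Ω → Param M} (hX : Measurable[m] X) :
    Measurable[m] fun s => R.train t s n (X s) i := by
  induction i with
  | zero => simpa only [train] using hX
  | succ i ih =>
    have h := ih (by omega) fun k hk => hb k (by omega)
    simp only [train]
    exact h.sub ((measurable_batchGrad_comp S (hb i (by omega))
      (fun s => R.batch_subset t n i s (by omega)) h).const_smul S.rate)

lemma measurable_aggregate {t j : ℕ} (hj : j ≤ S.numAgg)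
    (hr : ∀ n k, ∀ j < S.numAgg, ∀ l < S.numPackets, Measurable[m] (R.received t n k j l))
    {W : Ω → Fin N → Param M} (hW : ∀ n, Measurable[m] fun s => W s n) (n : Fin N) :
    Measurable[m] fun s => R.aggregate t s (W s) j n := by
  induction j generalizing n with
  | zero => simpa only [aggregate] using hW n
  | succ j ih =>
    simp only [aggregate]
    refine Finset.measurable_sum _ fun k _ => Measurable.const_smul ?_ (S.coeff t n k)
    exact measurable_receivedPart S (hr n k j hj) (ih (by omega) k)

lemma measurable_start {t : ℕ}
    (hb : ∀ t' < t, ∀ n, ∀ i < S.numLocal, Measurable[m, ⊤] (R.batch t' n i))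
    (hr : ∀ t' < t, ∀ n k, ∀ j < S.numAgg, ∀ l < S.numPackets,
      Measurable[m] (R.received t' n k j l)) (n : Fin N) :
    Measurable[m] fun s => R.start s t n := by
  induction t generalizing n with
  | zero => simp only [start]; exact measurable_const
  | succ t ih =>
    simp only [start]
    refine R.measurable_aggregate le_rfl (hr t (by omega)) (fun k => ?_) n
    exact (R.measurable_train le_rfl (hb t (by omega) k) (ih (fun t' h => hb t' (by omega))
      (fun t' h => hr t' (by omega)) k)).const_smul ((N : ℝ) * S.p k)

/-- The σ-algebra `m` is left free: it is taken to be the ambient one for plain measurability, and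
the one generated by all variables except a single mini-batch for independence. Receptions of all
rounds may be included, since only mini-batches must be excluded. -/
lemma measurable_localModel_of_past {t : ℕ} {n : Fin N} {i : ℕ} (hi : i ≤ S.numLocal)
    (hb : ∀ t' n' i', i' < S.numLocal → (t' < t ∨ t' = t ∧ i' < i) →
      Measurable[m, ⊤] (R.batch t' n' i'))
    (hr : ∀ t' n k, ∀ j < S.numAgg, ∀ l < S.numPackets, Measurable[m] (R.received t' n k j l)) :
    Measurable[m] (R.localModel t n i) := by
  unfold localModel
  exact R.measurable_train hi (fun k hk => hb t n k (by omega) (Or.inr ⟨rfl, hk⟩))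
    (R.measurable_start (fun t' ht n' i' hi' => hb t' n' i' hi' (Or.inl ht))
      (fun t' _ => hr t') n)

end Measurability

variable {N M : ℕ} {δ : Type*} {S : System N M δ} {Ω : Type*} [mΩ : MeasurableSpace Ω]
  {P : Measure Ω} (R : Randomness S P)

lemma measurable_localModel (t : ℕ) (n : Fin N) {i : ℕ} (hi : i ≤ S.numLocal) :
    Measurable (R.localModel t n i) :=
  R.measurable_localModel_of_past hi (fun t' n' i' h _ => R.batch_measurable t' n' i' h)
    fun t' n k j hj l hl => R.received_measurable t' n k j l hj hl

/-- Transfers almost sure bounds on iterates with `i < I` to the aggregated models, as `0 < I`. -/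
lemma aggModel_numAgg (t : ℕ) (n : Fin N) :
    R.aggModel t n S.numAgg = R.localModel (t + 1) n 0 := rfl

lemma measurable_globalModel (t : ℕ) : Measurable (R.globalModel t) := by
  unfold globalModel
  exact Finset.measurable_sum _ fun n _ => (R.measurable_localModel t n le_rfl).const_smul (S.p n)

/-- A mini-batch is independent of the model at which it is used. -/
lemma indep_localModel_batch (t : ℕ) (n : Fin N) {i : ℕ} (hi : i < S.numLocal) :
    Indep (MeasurableSpace.comap (R.localModel t n i) inferInstance)
      (MeasurableSpace.comap (R.batch t n i) ⊤) P := by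
  set F : (ℕ × Fin N × Fin S.numLocal) ⊕ (ℕ × Fin N × Fin N × Fin S.numAgg × Fin S.numPackets) →
    MeasurableSpace Ω := Sum.elim
      (fun q => MeasurableSpace.comap (R.batch q.1 q.2.1 q.2.2) ⊤)
      (fun q => MeasurableSpace.comap (R.received q.1 q.2.1 q.2.2.1 q.2.2.2.1 q.2.2.2.2) ⊤)
  have hle : ∀ k, F k ≤ mΩ := by
    rintro (⟨t', n', i'⟩ | ⟨t', n', k', j', l'⟩)
    · exact (R.batch_measurable t' n' i' i'.2).comap_le
    · exact (R.received_measurable t' n' k' j' l' j'.2 l'.2).comap_le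
  let q₀ : (ℕ × Fin N × Fin S.numLocal) ⊕ (ℕ × Fin N × Fin N × Fin S.numAgg × Fin S.numPackets) :=
    Sum.inl (t, n, ⟨i, hi⟩)
  -- The mini-batch `q₀` is independent of all other variables jointly, and the iterate depends only
  -- on those.
  have hind := indep_iSup_of_disjoint hle R.indep (S := {q₀}ᶜ) (T := {q₀}) disjoint_compl_left
  rw [iSup_singleton] at hind
  refine indep_of_indep_of_le_left hind (Measurable.comap_le ?_)
  have hF_meas : ∀ q, q ≠ q₀ → F q ≤ ⨆ k ∈ ({q₀}ᶜ : Set _), F k := fun q hq =>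
    le_iSup₂ (f := fun k (_ : k ∈ ({q₀}ᶜ : Set _)) => F k) q hq
  refine R.measurable_localModel_of_past hi.le (fun t' n' i' hi' hlt => ?_)
    fun t' n' k j hj l hl => ?_
  · refine Measurable.mono (comap_measurable (m := ⊤) (R.batch t' n' i'))
      (hF_meas (Sum.inl (t', n', ⟨i', hi'⟩)) fun h => ?_) le_rfl
    simp only [q₀, Sum.inl.injEq, Prod.mk.injEq, Fin.mk.injEq] at h
    omega
  · exact Measurable.mono (comap_measurable (m := ⊤) (R.received t' n' k j l))
      (hF_meas (Sum.inr (t', n', k, ⟨j, hj⟩, ⟨l, hl⟩)) (by simp [q₀])) le_rfl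

end Randomness

/-! ### Uniform bounds on iterates and stochastic gradients -/

namespace Assumptions

variable {N M : ℕ} {δ : Type*} {S : System N M δ} {Ω : Type*} [mΩ : MeasurableSpace Ω]
  {P : Measure Ω} [IsProbabilityMeasure P] {R : Randomness S P} {L μ G : ℝ} {σ : Fin N → ℝ}

/-- The bound on the stochastic gradients bounds the gradient at the iterates, and by strong
convexity confines them to a ball. -/
lemma ae_norm_localModel_le (hA : Assumptions R L μ G σ) (t : ℕ) (n : Fin N) {i : ℕ}
    (hi : i < S.numLocal) :
    ∀ᵐ s ∂P, ‖R.localModel t n i s‖ ≤ ((1 + G ^ 2) / 2 + ‖gradient (S.localLoss n) 0‖) / μ := by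
  filter_upwards [hA.second_moment t n i hi, hA.unbiased t n i hi] with s h2 h1
  set x := R.localModel t n i s
  have hmem : ∀ s', R.batch t n i s' ∈ (S.data n).powerset := fun s' =>
    Finset.mem_powerset.2 (R.batch_subset t n i s' hi)
  have hb := R.batch_measurable t n i hi
  -- The constant comes from `a ≤ (1 + a²)/2`, applied to the norm of the stochastic gradient under
  -- the integral; any finite bound suffices.
  have hgrad : ‖gradient (S.localLoss n) x‖ ≤ (1 + G ^ 2) / 2 := by
    rw [← h1]
    calc ‖∫ s', S.batchGrad (R.batch t n i s') x ∂P‖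
        ≤ ∫ s', ‖S.batchGrad (R.batch t n i s') x‖ ∂P := norm_integral_le_integral_norm _
      _ ≤ ∫ s', (1 + ‖S.batchGrad (R.batch t n i s') x‖ ^ 2) / 2 ∂P := by
          refine integral_mono
            (integrable_of_mem_finset hb hmem fun A => ‖S.batchGrad A x‖)
            (integrable_of_mem_finset hb hmem fun A => (1 + ‖S.batchGrad A x‖ ^ 2) / 2)
            fun s' => ?_
          nlinarith [sq_nonneg (‖S.batchGrad (R.batch t n i s') x‖ - 1)]
      _ = (1 + ∫ s', ‖S.batchGrad (R.batch t n i s') x‖ ^ 2 ∂P) / 2 := by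
          rw [integral_div, integral_add (integrable_const _)
            (integrable_of_mem_finset hb hmem fun A => ‖S.batchGrad A x‖ ^ 2)]
          simp
      _ ≤ (1 + G ^ 2) / 2 := by gcongr
  have hsc := norm_sub_le_of_strongConvexOn (hA.local_strongConvex n)
    (S.differentiable_localLoss n) 0 x
  rw [le_div_iff₀ hA.μ_pos, mul_comm]
  rw [sub_zero] at hsc
  exact hsc.trans ((norm_sub_le _ _).trans (by gcongr))

lemma exists_ae_norm_localModel_le (hA : Assumptions R L μ G σ) :
    ∃ B : ℝ, 0 ≤ B ∧ ∀ t n, ∀ i < S.numLocal, ∀ᵐ s ∂P, ‖R.localModel t n i s‖ ≤ B := by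
  have hpos := hA.μ_pos
  -- The sum over devices dominates each radius and, unlike a maximum, also makes sense for `N = 0`.
  refine ⟨∑ n, ((1 + G ^ 2) / 2 + ‖gradient (S.localLoss n) 0‖) / μ,
    Finset.sum_nonneg fun n _ => by positivity, fun t n i hi => ?_⟩
  filter_upwards [hA.ae_norm_localModel_le t n hi] with s hs
  exact hs.trans (Finset.single_le_sum
    (f := fun n => ((1 + G ^ 2) / 2 + ‖gradient (S.localLoss n) 0‖) / μ)
    (fun n _ => by positivity) (Finset.mem_univ n))

/-- The assumed bound freezes the iterate; independence of iterate and mini-batch turns it into a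
bound on the full expectation. -/
lemma lintegral_batchGrad_sq_le (hA : Assumptions R L μ G σ) (t : ℕ) (n : Fin N) {i : ℕ}
    (hi : i < S.numLocal) :
    ∫⁻ s, ENNReal.ofReal (‖S.batchGrad (R.batch t n i s) (R.localModel t n i s)‖ ^ 2) ∂P
      ≤ ENNReal.ofReal (G ^ 2) := by
  have hmem : ∀ s', R.batch t n i s' ∈ (S.data n).powerset := fun s' =>
    Finset.mem_powerset.2 (R.batch_subset t n i s' hi)
  have hb := R.batch_measurable t n i hi
  rw [lintegral_eq_iterated_of_indep (R.measurable_localModel t n hi.le).comap_le hb hmem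
    (comap_measurable _) (R.indep_localModel_batch t n hi)
    (H := fun A x => ENNReal.ofReal (‖S.batchGrad A x‖ ^ 2))
    fun A => ((S.measurable_batchGrad A).norm.pow_const 2).ennreal_ofReal]
  calc _ ≤ ∫⁻ _, ENNReal.ofReal (G ^ 2) ∂P := by
        refine lintegral_mono_ae ?_
        filter_upwards [hA.second_moment t n i hi] with s hs
        rw [← ofReal_integral_eq_lintegral_ofReal
          (integrable_of_mem_finset hb hmem
            fun A => ‖S.batchGrad A (R.localModel t n i s)‖ ^ 2)
          (Eventually.of_forall fun _ => by positivity)]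
        exact ENNReal.ofReal_le_ofReal hs
    _ = ENNReal.ofReal (G ^ 2) := by simp

end Assumptions

lemma norm_sub_sq_le {E : Type*} [SeminormedAddCommGroup E] (a b : E) :
    ‖a - b‖ ^ 2 ≤ 2 * ‖a‖ ^ 2 + 2 * ‖b‖ ^ 2 := by
  have h := norm_sub_le a b
  nlinarith [sq_nonneg (‖a‖ - ‖b‖), norm_nonneg (a - b), norm_nonneg a, norm_nonneg b]

lemma ofReal_two_mul_add {a b : ℝ} (ha : 0 ≤ a) (hb : 0 ≤ b) :
    ENNReal.ofReal (2 * a + 2 * b) = 2 * ENNReal.ofReal a + 2 * ENNReal.ofReal b := by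
  rw [ENNReal.ofReal_add (by positivity) (by positivity), ENNReal.ofReal_mul zero_le_two,
    ENNReal.ofReal_mul zero_le_two, ENNReal.ofReal_ofNat]

lemma System.norm_sum_p_smul_sq_le {N M : ℕ} {δ : Type*} (S : System N M δ) (x : Fin N → Param M) :
    ‖∑ n, S.p n • x n‖ ^ 2 ≤ ∑ n, S.p n * ‖x n‖ ^ 2 := by
  rcases isEmpty_or_nonempty (Fin N) with _ | ⟨⟨n⟩⟩
  · simp
  · have hc : ConvexOn ℝ Set.univ fun x : Param M => ‖x‖ ^ 2 :=
      convexOn_univ_norm.pow (fun x _ => norm_nonneg x) 2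
    exact hc.map_sum_le (fun n _ => S.p_nonneg n) (S.sum_p n) fun _ _ => Set.mem_univ _

lemma System.lintegral_sum_p_mul_le {N M : ℕ} {δ Ω : Type*} (S : System N M δ)
    [MeasurableSpace Ω] {P : Measure Ω} {f : Fin N → Ω → ℝ} (hf : ∀ n s, 0 ≤ f n s)
    (hfm : ∀ n, Measurable (f n)) {C : ℝ≥0∞} (hC : ∀ n, ∫⁻ s, ENNReal.ofReal (f n s) ∂P ≤ C) :
    ∫⁻ s, ENNReal.ofReal (∑ n, S.p n * f n s) ∂P ≤ C := by
  have hs : ∀ s, ENNReal.ofReal (∑ n, S.p n * f n s)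
      = ∑ n, ENNReal.ofReal (S.p n) * ENNReal.ofReal (f n s) := fun s => by
    rw [ENNReal.ofReal_sum_of_nonneg fun n _ => mul_nonneg (S.p_nonneg n) (hf n s)]
    exact Finset.sum_congr rfl fun n _ => ENNReal.ofReal_mul (S.p_nonneg n)
  simp_rw [hs]
  rw [lintegral_finsetSum _ fun n _ => (hfm n).ennreal_ofReal.const_mul _]
  calc _ ≤ ∑ n, ENNReal.ofReal (S.p n) * C := by
        refine Finset.sum_le_sum fun n _ => ?_
        rw [lintegral_const_mul _ (hfm n).ennreal_ofReal]
        gcongr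
        exact hC n
    _ = ENNReal.ofReal (∑ n, S.p n) * C := by
        rw [← Finset.sum_mul, ENNReal.ofReal_sum_of_nonneg fun n _ => S.p_nonneg n]
    -- The weights sum to `1`, or to `0` when there are no devices.
    _ ≤ 1 * C := by
        gcongr
        rw [ENNReal.ofReal_le_one]
        simpa using S.sum_p_mul_le (a := fun _ => 1) zero_le_one fun _ => le_rfl
    _ = C := one_mul C

/-! ### Mean-square bounds uniform in the round -/

namespace Assumptions

variable {N M : ℕ} {δ : Type*} {S : System N M δ} {Ω : Type*} [mΩ : MeasurableSpace Ω]
  {P : Measure Ω} [IsProbabilityMeasure P] {R : Randomness S P} {L μ G : ℝ} {σ : Fin N → ℝ}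

/-- The ball bound stops at index `I - 1`, so the last gradient step is estimated separately. -/
lemma lintegral_localModel_numLocal_le (hA : Assumptions R L μ G σ) {B : ℝ}
    (hB : ∀ t n, ∀ i < S.numLocal, ∀ᵐ s ∂P, ‖R.localModel t n i s‖ ≤ B) (t : ℕ) (n : Fin N) :
    ∫⁻ s, ENNReal.ofReal (‖R.localModel t n S.numLocal s‖ ^ 2) ∂P
      ≤ 2 * ENNReal.ofReal (B ^ 2)
        + 2 * (ENNReal.ofReal (S.rate ^ 2) * ENNReal.ofReal (G ^ 2)) := by
  obtain ⟨i, hi⟩ : ∃ i, S.numLocal = i + 1 := Nat.exists_eq_succ_of_ne_zero S.numLocal_pos.ne'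
  have hlt : i < S.numLocal := by omega
  have hb : Measurable fun s => S.batchGrad (R.batch t n i s) (R.localModel t n i s) :=
    measurable_batchGrad_comp S (R.batch_measurable t n i hlt)
      (fun s => R.batch_subset t n i s hlt) (R.measurable_localModel t n hlt.le)
  calc _ ≤ ∫⁻ s, (2 * ENNReal.ofReal (B ^ 2) + 2 * (ENNReal.ofReal (S.rate ^ 2) *
          ENNReal.ofReal (‖S.batchGrad (R.batch t n i s) (R.localModel t n i s)‖ ^ 2))) ∂P := by
        refine lintegral_mono_ae ?_
        filter_upwards [hB t n i hlt] with s hs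
        rw [← ENNReal.ofReal_mul (by positivity),
          ← ofReal_two_mul_add (by positivity) (by positivity)]
        refine ENNReal.ofReal_le_ofReal ?_
        have hstep : R.localModel t n S.numLocal s = R.localModel t n i s
            - S.rate • S.batchGrad (R.batch t n i s) (R.localModel t n i s) := by
          rw [hi]; rfl
        rw [hstep]
        refine (norm_sub_sq_le _ _).trans ?_
        rw [norm_smul, mul_pow, Real.norm_eq_abs, sq_abs]
        gcongr
    _ ≤ _ := by
        rw [lintegral_add_left measurable_const, lintegral_const, measure_univ, mul_one,
          lintegral_const_mul _ ((hb.norm.pow_const 2).ennreal_ofReal.const_mul _),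
          lintegral_const_mul _ (hb.norm.pow_const 2).ennreal_ofReal]
        gcongr
        exact hA.lintegral_batchGrad_sq_le t n hlt

lemma exists_lintegral_globalModel_le (hA : Assumptions R L μ G σ) :
    ∃ C : ℝ≥0∞, C < ∞ ∧ ∀ t, ∫⁻ s, ENNReal.ofReal (‖R.globalModel t s‖ ^ 2) ∂P ≤ C := by
  obtain ⟨B, -, hB⟩ := hA.exists_ae_norm_localModel_le
  refine ⟨2 * ENNReal.ofReal (B ^ 2) + 2 * (ENNReal.ofReal (S.rate ^ 2) * ENNReal.ofReal (G ^ 2)),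
    by finiteness, fun t => ?_⟩
  refine (lintegral_mono fun s => ENNReal.ofReal_le_ofReal
    (S.norm_sum_p_smul_sq_le fun n => R.localModel t n S.numLocal s)).trans ?_
  exact S.lintegral_sum_p_mul_le (fun _ _ => by positivity)
    (fun n => (R.measurable_localModel t n le_rfl).norm.pow_const 2)
    (hA.lintegral_localModel_numLocal_le hB t)

lemma exists_globalError_le (hA : Assumptions R L μ G σ) (x : Param M) :
    ∃ C : ℝ≥0∞, C < ∞ ∧ ∀ t, R.globalError x t ≤ C := by
  obtain ⟨C, hC, h⟩ := hA.exists_lintegral_globalModel_le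
  refine ⟨2 * C + 2 * ENNReal.ofReal (‖x‖ ^ 2), by finiteness, fun t => ?_⟩
  unfold Randomness.globalError
  calc _ ≤ ∫⁻ s, (2 * ENNReal.ofReal (‖R.globalModel t s‖ ^ 2)
          + 2 * ENNReal.ofReal (‖x‖ ^ 2)) ∂P := by
        refine lintegral_mono fun s => ?_
        rw [← ofReal_two_mul_add (by positivity) (by positivity)]
        exact ENNReal.ofReal_le_ofReal (norm_sub_sq_le _ _)
    _ ≤ _ := by
        rw [lintegral_add_right _ measurable_const, lintegral_const, measure_univ, mul_one,
          lintegral_const_mul _ ((R.measurable_globalModel t).norm.pow_const 2).ennreal_ofReal]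
        gcongr
        exact h t

/-- The bias is the global model, bounded in mean square, minus the next starting model, bounded
almost surely. -/
lemma exists_biasError_le (hA : Assumptions R L μ G σ) :
    ∃ C : ℝ≥0∞, C < ∞ ∧ ∀ t, R.biasError t ≤ C := by
  obtain ⟨C, hC, h⟩ := hA.exists_lintegral_globalModel_le
  obtain ⟨B, -, hB⟩ := hA.exists_ae_norm_localModel_le
  refine ⟨2 * C + 2 * ENNReal.ofReal (B ^ 2), by finiteness, fun t => ?_⟩
  unfold Randomness.biasError
  calc _ ≤ ∫⁻ s, (2 * ENNReal.ofReal (‖R.globalModel t s‖ ^ 2)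
          + 2 * ENNReal.ofReal (B ^ 2)) ∂P := by
        refine lintegral_mono_ae ?_
        filter_upwards [ae_all_iff.2 fun n => hB (t + 1) n 0 S.numLocal_pos] with s hs
        rw [← ofReal_two_mul_add (by positivity) (by positivity)]
        refine ENNReal.ofReal_le_ofReal (S.sum_p_mul_le (by positivity) fun n => ?_)
        unfold Randomness.bias
        refine (norm_sub_sq_le _ _).trans ?_
        rw [R.aggModel_numAgg]
        gcongr
        exact hs n
    _ ≤ _ := by
        rw [lintegral_add_right _ measurable_const, lintegral_const, measure_univ, mul_one,
          lintegral_const_mul _ ((R.measurable_globalModel t).norm.pow_const 2).ennreal_ofReal]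
        gcongr
        exact h t

lemma exists_deviceError_le (hA : Assumptions R L μ G σ) (x : Param M) (n : Fin N) :
    ∃ C : ℝ≥0∞, C < ∞ ∧ ∀ t, R.deviceError x n t ≤ C := by
  obtain ⟨B, -, hB⟩ := hA.exists_ae_norm_localModel_le
  refine ⟨ENNReal.ofReal (2 * B ^ 2 + 2 * ‖x‖ ^ 2), by finiteness, fun t => ?_⟩
  unfold Randomness.deviceError
  calc _ ≤ ∫⁻ _, ENNReal.ofReal (2 * B ^ 2 + 2 * ‖x‖ ^ 2) ∂P := by
        refine lintegral_mono_ae ?_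
        filter_upwards [hB (t + 1) n 0 S.numLocal_pos] with s hs
        refine ENNReal.ofReal_le_ofReal ((norm_sub_sq_le _ _).trans ?_)
        rw [R.aggModel_numAgg]
        gcongr
    _ = _ := by simp

end Assumptions

/-! ### The error decomposition and passage to the limit superior -/

lemma Randomness.weightedError_le {N M : ℕ} {δ : Type*} {S : System N M δ} {Ω : Type*}
    [MeasurableSpace Ω] {P : Measure Ω} (R : Randomness S P) (x : Param M) (t : ℕ) :
    R.weightedError x t ≤ 2 * (R.globalError x t + R.biasError t) := by
  unfold weightedError globalError biasError
  have hm : Measurable fun s => ENNReal.ofReal (‖R.globalModel t s - x‖ ^ 2) :=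
    (((R.measurable_globalModel t).sub_const x).norm.pow_const 2).ennreal_ofReal
  rw [← lintegral_add_left hm, ← lintegral_const_mul' _ _ (by finiteness)]
  refine lintegral_mono fun s => ?_
  have hnn : 0 ≤ ∑ n, S.p n * ‖R.bias t n s‖ ^ 2 :=
    Finset.sum_nonneg fun n _ => mul_nonneg (S.p_nonneg n) (by positivity)
  rw [mul_add, ← ofReal_two_mul_add (by positivity) hnn]
  refine ENNReal.ofReal_le_ofReal ?_
  calc ∑ n, S.p n * ‖R.aggModel t n S.numAgg s - x‖ ^ 2
      ≤ ∑ n, S.p n * (2 * ‖R.globalModel t s - x‖ ^ 2 + 2 * ‖R.bias t n s‖ ^ 2) := by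
        refine Finset.sum_le_sum fun n _ => mul_le_mul_of_nonneg_left ?_ (S.p_nonneg n)
        have h : R.aggModel t n S.numAgg s - x = (R.globalModel t s - x) - R.bias t n s := by
          unfold bias; abel
        rw [h]
        exact norm_sub_sq_le _ _
    _ = ∑ n, S.p n * (2 * ‖R.globalModel t s - x‖ ^ 2)
          + 2 * ∑ n, S.p n * ‖R.bias t n s‖ ^ 2 := by
        rw [Finset.mul_sum, ← Finset.sum_add_distrib]
        exact Finset.sum_congr rfl fun n _ => by ring
    _ ≤ _ := by
        gcongr
        exact S.sum_p_mul_le (by positivity) fun _ => le_rfl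

lemma limsup_lt_top_of_forall_le {u : ℕ → ℝ≥0∞} (h : ∃ C : ℝ≥0∞, C < ∞ ∧ ∀ t, u t ≤ C) :
    limsup u atTop < ∞ := by
  obtain ⟨C, hC, hu⟩ := h
  exact (limsup_le_of_le (h := Eventually.of_forall hu)).trans_lt hC

/-- If the right side is finite, each sequence is eventually below its limit superior plus `ε/2`;
otherwise there is nothing to prove. -/
lemma limsup_add_le_add_limsup (u v : ℕ → ℝ≥0∞) :
    limsup (fun t => u t + v t) atTop ≤ limsup u atTop + limsup v atTop := by
  refine ENNReal.le_of_forall_pos_le_add fun ε hε hlt => ?_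
  have hε2 : (0 : ℝ≥0∞) < (ε / 2 : ℝ≥0) := by exact_mod_cast half_pos hε
  have hu : limsup u atTop ≠ ∞ := (le_self_add.trans_lt hlt).ne
  have hv : limsup v atTop ≠ ∞ := (le_add_self.trans_lt hlt).ne
  have h1 := eventually_lt_of_limsup_lt (ENNReal.lt_add_right hu hε2.ne')
  have h2 := eventually_lt_of_limsup_lt (ENNReal.lt_add_right hv hε2.ne')
  refine limsup_le_of_le (h := ?_)
  filter_upwards [h1, h2] with t ht1 ht2
  refine (add_le_add ht1.le ht2.le).trans (le_of_eq ?_)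
  rw [add_add_add_comm, ← ENNReal.coe_add, add_halves]

end DFL

theorem corollary1 {N M : ℕ} {δ : Type*} (S : DFL.System N M δ)
    {Ω : Type*} [MeasurableSpace Ω] (P : Measure Ω) [IsProbabilityMeasure P]
    (R : DFL.Randomness S P) (L μ G : ℝ) (σ : Fin N → ℝ)
    (hA : DFL.Assumptions R L μ G σ)
    (xstar : DFL.Param M) (hstar : ∀ x, S.globalLoss xstar ≤ S.globalLoss x) :
    (∀ t, R.weightedError xstar t ≤ 2 * (R.globalError xstar t + R.biasError t) ∧
      2 * (R.globalError xstar t + R.biasError t) < ∞) ∧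
    limsup (R.weightedError xstar) atTop
      ≤ 2 * (limsup (R.globalError xstar) atTop + limsup R.biasError atTop) ∧
    2 * (limsup (R.globalError xstar) atTop + limsup R.biasError atTop) < ∞ ∧
    ∀ n, limsup (R.deviceError xstar n) atTop < ∞ := by
  have hglobal := hA.exists_globalError_le xstar
  have hbias := hA.exists_biasError_le
  refine ⟨fun t => ⟨R.weightedError_le xstar t, ?_⟩, ?_, ?_, fun n =>
    DFL.limsup_lt_top_of_forall_le (hA.exists_deviceError_le xstar n)⟩
  · obtain ⟨C, hC, h⟩ := hglobal
    obtain ⟨C', hC', h'⟩ := hbias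
    exact ENNReal.mul_lt_top (by finiteness)
      (ENNReal.add_lt_top.2 ⟨(h t).trans_lt hC, (h' t).trans_lt hC'⟩)
  · calc limsup (R.weightedError xstar) atTop
        ≤ limsup (fun t => 2 * (R.globalError xstar t + R.biasError t)) atTop :=
          limsup_le_limsup (Eventually.of_forall fun t => R.weightedError_le xstar t)
      _ = 2 * limsup (fun t => R.globalError xstar t + R.biasError t) atTop :=
          ENNReal.limsup_const_mul_of_ne_top (by finiteness)
      _ ≤ _ := by
          gcongr
          exact DFL.limsup_add_le_add_limsup _ _
  · exact ENNReal.mul_lt_top (by finiteness) (ENNReal.add_lt_top.2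
      ⟨DFL.limsup_lt_top_of_forall_le hglobal, DFL.limsup_lt_top_of_forall_le hbias⟩)
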